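/- A degree sequence of length $n$ is a sequence $D=(d_1,\dots,d_n)$ of positive integers with $d_i\le n-1$ for all $i$ and with $\sum_i d_i$ even. For an arbitrary vector $D\in\mathbb{N}^n$ let $\mathcal{G}(D)$ be the set of simple graphs on the vertex set $\{1,\dots,n\}$ in which vertex $i$ has degree $d_i$ for every $i$; $D$ is graphic if $\mathcal{G}(D)\neq\emptyset$. For $1\le i,j\le n$ let $1^{+i}_{+j}=e_i+e_j$, where $e_1,\dots,e_n$ are the standard unit vectors (so $1^{+i}_{+i}=2e_i$), and for a graphic $D$ put $$\partial^{++}(D)=\sum_{1\le i<j\le n}\frac{|\mathcal{G}(D+1^{+i}_{+j})|}{|\mathcal{G}(D)|}.$$ For a non-negative integer $\Sigma$ and positive integers $n>c_1\ge c_2$ let $\mathbb{D}(n,\Sigma,c_1,c_2)$ be the set of all degree sequences $D$ of length $n$ with $\sum_i d_i=\Sigma$ and $c_2\le d_i\le c_1$ for all $i$. Theorem. If $\mathbb{D}(n,\Sigma,c_1,c_2)$ is fully graphic, that is, if every one of its members is graphic, then $\partial^{++}(D)\le 3\,n^{13}$ for every $D\in\mathbb{D}(n,\Sigma,c_1,c_2)$.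 The same bound holds when the sum defining $\partial^{++}(D)$ is extended to all pairs $1\le i\le j\le n$. -/

import Mathlib

namespace DegreeRegion

/-- A degree sequence of length `n`: positive integers, none exceeding `n - 1`, with even sum. -/
def IsDegreeSequence {n : ℕ} (d : Fin n → ℕ) : Prop :=
  (∀ i, 0 < d i ∧ d i < n) ∧ Even (∑ i, d i)

open Classical in
/-- The set `𝒢(d)` of realizations of `d`: the simple graphs on the labelled vertex set `Fin n` in
which vertex `v` has degree `d v`. It makes sense for every vector of natural numbers. -/
def realizations {n : ℕ} (d : Fin n → ℕ) : Set (SimpleGraph (Fin n)) :=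
  {G | ∀ v, G.degree v = d v}

/-- A vector is graphic if it has a realization. -/
def IsGraphic {n : ℕ} (d : Fin n → ℕ) : Prop :=
  (realizations d).Nonempty

/-- The simple region `𝔻(n, S, a, b)`: the degree sequences of length `n` with sum `S`, largest
entry at most `a` and smallest entry at least `b`. -/
def simpleRegion (n S a b : ℕ) : Set (Fin n → ℕ) :=
  {d | IsDegreeSequence d ∧ (∀ i, d i ≤ a) ∧ (∀ i, b ≤ d i) ∧ ∑ i, d i = S}

/-- A region is fully graphic if each of its members is graphic. -/
def FullyGraphic {n : ℕ} (R : Set (Fin n → ℕ)) : Prop :=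
  ∀ d ∈ R, IsGraphic d

/-- The perturbation `d + 1^{+i}_{+j}`; for `i = j` it adds `2` to the `i`-th entry. -/
def perturb {n : ℕ} (d : Fin n → ℕ) (i j : Fin n) : Fin n → ℕ :=
  d + Pi.single i 1 + Pi.single j 1

/-- `∂⁺⁺(d)`, the sum over all pairs `i < j` of `|𝒢(d + 1^{+i}_{+j})| / |𝒢(d)|`. -/
noncomputable def boundary {n : ℕ} (d : Fin n → ℕ) : ℚ :=
  ∑ p : Fin n × Fin n with p.1 < p.2,
    ((realizations (perturb d p.1 p.2)).ncard : ℚ) / ((realizations d).ncard : ℚ)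

/-- The variant of `∂⁺⁺(d)` that also counts the perturbations with `i = j`. -/
noncomputable def boundaryWithDiagonal {n : ℕ} (d : Fin n → ℕ) : ℚ :=
  ∑ p : Fin n × Fin n with p.1 ≤ p.2,
    ((realizations (perturb d p.1 p.2)).ncard : ℚ) / ((realizations d).ncard : ℚ)

end DegreeRegion

/-!
A realization `G` of `d + 1^{+x}_{+y}` is turned into a realization of `d` by toggling the steps of
an alternating trail of edges and non-edges from `y` to `x`. If the trail always has bounded length,
its list of vertices and the toggled graph determine `G`, which bounds `|𝒢(d + 1^{+x}_{+y})|` by a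
power of `n` times `|𝒢(d)|`.

Suppose that every neighbour of `y` is a neighbour of `x` but that no trail of length at most nine
exists. Then the neighbours of `y` and the vertices reached from `y` twice by alternating paths form
a clique `A` joined to everything outside the set `M` of their non-neighbours, while a subset
`B ∋ y` of `M` has no edge to `M`. Moving degrees out of `M` as long as the region allows ends with
all entries of `M` minimal or all entries off `M` maximal, and the structure of `A`, `B`, `M` shows
that either sequence violates the Erdős–Gallai inequality although it belongs to the fully graphic
region.

If `y` has a neighbour that is not one of `x`, one further exchange reduces to the case `x = y`.
-/

open Finset
open scoped symmDiff

namespace DegreeRegion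

section Toggling

variable {V : Type*}

theorem mem_edgeSet_symmDiff_edge_iff {G : SimpleGraph V} {a b : V} {e : Sym2 V} (h : e ≠ s(a, b)) :
    e ∈ (G ∆ SimpleGraph.edge a b).edgeSet ↔ e ∈ G.edgeSet := by
  induction e with | _ c d
  have hedge : ¬ (SimpleGraph.edge a b).Adj c d :=
    fun h' => h (SimpleGraph.adj_edge _ _ |>.1 h').1.symm
  rw [SimpleGraph.mem_edgeSet, SimpleGraph.mem_edgeSet, symmDiff, SimpleGraph.sup_adj,
    SimpleGraph.sdiff_adj, SimpleGraph.sdiff_adj]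
  tauto

theorem compl_adj_symmDiff_edge {G : SimpleGraph V} {a b : V} (h : G.Adj a b) :
    (G ∆ SimpleGraph.edge a b)ᶜ.Adj a b := by
  simp [symmDiff, SimpleGraph.edge_adj, h, h.ne]

theorem degree_edge [Fintype V] [DecidableEq V] {a b : V} (h : a ≠ b) (v : V) :
    (SimpleGraph.edge a b).degree v = (Pi.single a 1 + Pi.single b 1 : V → ℕ) v := by
  have hnbr : (SimpleGraph.edge a b).neighborFinset v =
      if v = a then {b} else if v = b then {a} else ∅ := by
    ext w
    rw [SimpleGraph.mem_neighborFinset, SimpleGraph.edge_adj]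
    split_ifs <;> simp <;> grind
  rw [← SimpleGraph.card_neighborFinset_eq_degree, hnbr, Pi.add_apply, Pi.single_apply,
    Pi.single_apply]
  split_ifs <;> grind

theorem degree_symmDiff_edge [Fintype V] [DecidableEq V] {G : SimpleGraph V} [DecidableRel G.Adj]
    {a b : V} [DecidableRel (G ∆ SimpleGraph.edge a b).Adj] (h : Gᶜ.Adj a b) (v : V) :
    (G ∆ SimpleGraph.edge a b).degree v =
      G.degree v + (Pi.single a 1 + Pi.single b 1 : V → ℕ) v := by
  have hdisj : Disjoint G (SimpleGraph.edge a b) := SimpleGraph.disjoint_edge G |>.2 h.2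
  rw [← degree_edge h.ne, ← SimpleGraph.card_neighborFinset_eq_degree,
    ← SimpleGraph.card_neighborFinset_eq_degree, ← SimpleGraph.card_neighborFinset_eq_degree,
    ← card_union_of_disjoint (SimpleGraph.disjoint_neighborFinset_of_disjoint _ _ v hdisj)]
  congr 1
  ext w
  simp [hdisj.symmDiff_eq_sup]

end Toggling

section Realizations

variable {n : ℕ} {d e : Fin n → ℕ} {G : SimpleGraph (Fin n)} {a b x y z w : Fin n}

theorem mem_realizations [DecidableRel G.Adj] : G ∈ realizations d ↔ ∀ v, G.degree v = d v := by
  rw [realizations, Set.mem_ofPred_eq]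
  convert Iff.rfl

theorem eq_of_mem_realizations (hd : G ∈ realizations d) (he : G ∈ realizations e) : d = e := by
  classical
  exact funext fun v => (mem_realizations.1 hd v).symm.trans (mem_realizations.1 he v)

theorem degree_eq_of_mem_realizations_perturb [DecidableRel G.Adj]
    (hG : G ∈ realizations (perturb d x y)) (v : Fin n) :
    G.degree v = d v + (if v = x then 1 else 0) + (if v = y then 1 else 0) := by
  simpa only [perturb, Pi.add_apply, Pi.single_apply] using mem_realizations.1 hG v

theorem perturb_comm (d : Fin n → ℕ) (i j : Fin n) : perturb d i j = perturb d j i :=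
  add_right_comm _ _ _

theorem symmDiff_edge_mem_realizations_perturb (h : Gᶜ.Adj a b) (hG : G ∈ realizations d) :
    G ∆ SimpleGraph.edge a b ∈ realizations (perturb d a b) := by
  classical
  refine mem_realizations.2 fun v => ?_
  rw [degree_symmDiff_edge h, mem_realizations.1 hG v, perturb, add_assoc]
  rfl

theorem symmDiff_edge_mem_realizations (h : G.Adj a b) (hG : G ∈ realizations (perturb d a b)) :
    G ∆ SimpleGraph.edge a b ∈ realizations d := by
  classical
  set H := G ∆ SimpleGraph.edge a b
  have hHdeg : H ∈ realizations (H.degree ·) := mem_realizations.2 fun _ => rfl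
  have hGdeg : G ∈ realizations (perturb (H.degree ·) a b) := by
    rw [← symmDiff_symmDiff_cancel_right (SimpleGraph.edge a b) G]
    exact symmDiff_edge_mem_realizations_perturb (compl_adj_symmDiff_edge h) hHdeg
  have hd : (H.degree ·) = d :=
    add_right_cancel (add_right_cancel (eq_of_mem_realizations hGdeg hG))
  exact hd ▸ hHdeg

theorem symmDiff_edge_symmDiff_edge_mem_realizations_perturb (hyw : G.Adj y w)
    (hwz : Gᶜ.Adj w z) (hG : G ∈ realizations (perturb d x y)) :
    G ∆ SimpleGraph.edge y w ∆ SimpleGraph.edge w z ∈ realizations (perturb d x z) := by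
  classical
  have hne : s(y, w) ≠ s(w, z) := fun h => hwz.2 (G.mem_edgeSet.1 (h ▸ hyw))
  have hGwz : G ∆ SimpleGraph.edge w z ∈ realizations (perturb (perturb d x z) y w) := by
    have := symmDiff_edge_mem_realizations_perturb hwz hG
    convert this using 2
    simp only [perturb]
    abel
  rw [symmDiff_right_comm]
  exact symmDiff_edge_mem_realizations ((mem_edgeSet_symmDiff_edge_iff hne).2 hyw) hGwz

end Realizations

section AlternatingTrails

variable {V : Type*}

/-- The graph of the pairs that occur an odd number of times as consecutive entries of a list.
Constant steps contribute nothing, so a list can be lengthened by repeating its first entry. -/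
def parityGraph : List V → SimpleGraph V
  | a :: b :: l => SimpleGraph.edge a b ∆ parityGraph (b :: l)
  | _ => ⊥

theorem parityGraph_cons_replicate_append (a : V) (l : List V) (k : ℕ) :
    parityGraph (a :: (List.replicate k a ++ l)) = parityGraph (a :: l) := by
  induction k with
  | zero => rfl
  | succ k ih =>
    rw [List.replicate_succ, List.cons_append, parityGraph, SimpleGraph.edge_self_eq_bot, ih,
      bot_symmDiff]

/-- The list of unordered pairs obtained by cutting a list into blocks of two. On `v₀ :: v₁ :: …`
these are the odd steps of the walk `v₀, v₁, …`, and on its tail the even steps. -/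
def blocks : List V → List (Sym2 V)
  | a :: b :: l => s(a, b) :: blocks l
  | _ => []

/-- `y :: l` is a walk to `x` whose steps are alternately edges and non-edges of `G`, the first and
the last step being edges. -/
def IsAltWalk (G : SimpleGraph V) (x : V) : V → List V → Prop
  | y, [w] => w = x ∧ G.Adj y w
  | y, w :: z :: l => G.Adj y w ∧ Gᶜ.Adj w z ∧ IsAltWalk G x z l
  | _, [] => False

/-- An alternating walk that uses no edge and no non-edge twice. -/
structure IsAltTrail (G : SimpleGraph V) (x y : V) (l : List V) : Prop where
  isAltWalk : IsAltWalk G x y l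
  nodup_edges : (blocks (y :: l)).Nodup
  nodup_nonedges : (blocks l).Nodup

variable {G H : SimpleGraph V} {x y : V} {l : List V}

theorem IsAltWalk.congr (hedge : ∀ e ∈ blocks (y :: l), e ∈ G.edgeSet → e ∈ H.edgeSet)
    (hnonedge : ∀ e ∈ blocks l, e ∈ H.edgeSet → e ∈ G.edgeSet) (h : IsAltWalk G x y l) :
    IsAltWalk H x y l := by
  induction l using List.twoStepInduction generalizing y with
  | nil => exact h
  | singleton w => exact ⟨h.1, hedge s(y, w) (by simp [blocks]) h.2⟩
  | cons_cons w z l ih _ =>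
    obtain ⟨hyw, hwz, hl⟩ := h
    exact ⟨hedge s(y, w) List.mem_cons_self hyw,
      ⟨hwz.1, fun h => hwz.2 (hnonedge s(w, z) List.mem_cons_self h)⟩,
      ih (fun e he => hedge e (List.mem_cons_of_mem _ he))
        (fun e he => hnonedge e (List.mem_cons_of_mem _ he)) hl⟩

theorem IsAltWalk.notMem_edgeSet_of_mem_blocks (h : IsAltWalk G x y l) {e : Sym2 V}
    (he : e ∈ blocks l) : e ∉ G.edgeSet := by
  induction l using List.twoStepInduction generalizing y with
  | nil => exact h.elim
  | singleton w => simp [blocks] at he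
  | cons_cons w z l ih _ =>
    rcases List.mem_cons.1 he with rfl | he
    · exact h.2.1.2
    · exact ih h.2.2 he

theorem IsAltTrail.of_cons_cons {w z : V} (h : IsAltTrail G x y (w :: z :: l)) :
    IsAltTrail (G ∆ SimpleGraph.edge y w ∆ SimpleGraph.edge w z) x z l := by
  obtain ⟨⟨hyw, hwz, hwalk⟩, hedges, hnonedges⟩ := h
  obtain ⟨hyw_notMem, hedges⟩ := List.nodup_cons.1 hedges
  obtain ⟨hwz_notMem, hnonedges⟩ := List.nodup_cons.1 hnonedges
  refine ⟨hwalk.congr (fun e he heG => ?_) (fun e he heG => ?_), hedges, hnonedges⟩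
  · have hne_yw : e ≠ s(y, w) := fun h => hyw_notMem (h ▸ he)
    have hne_wz : e ≠ s(w, z) := by
      rintro rfl
      exact hwz.2 heG
    rwa [mem_edgeSet_symmDiff_edge_iff hne_wz, mem_edgeSet_symmDiff_edge_iff hne_yw]
  · have hne_yw : e ≠ s(y, w) := by
      rintro rfl
      exact hwalk.notMem_edgeSet_of_mem_blocks he hyw
    have hne_wz : e ≠ s(w, z) := fun h => hwz_notMem (h ▸ he)
    rwa [mem_edgeSet_symmDiff_edge_iff hne_wz, mem_edgeSet_symmDiff_edge_iff hne_yw] at heG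

theorem IsAltTrail.symmDiff_parityGraph_mem_realizations {n : ℕ} {d : Fin n → ℕ}
    {G : SimpleGraph (Fin n)} {x y : Fin n} {l : List (Fin n)} (h : IsAltTrail G x y l)
    (hG : G ∈ realizations (perturb d x y)) : G ∆ parityGraph (y :: l) ∈ realizations d := by
  induction l using List.twoStepInduction generalizing G y with
  | nil => exact h.isAltWalk.elim
  | singleton w =>
    obtain ⟨rfl, hyw⟩ := h.isAltWalk
    simpa [parityGraph] using symmDiff_edge_mem_realizations hyw (perturb_comm d w y ▸ hG)
  | cons_cons w z l ih _ =>
    rw [parityGraph, parityGraph, ← symmDiff_assoc, ← symmDiff_assoc]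
    exact ih h.of_cons_cons
      (symmDiff_edge_symmDiff_edge_mem_realizations_perturb h.isAltWalk.1 h.isAltWalk.2.1 hG)

end AlternatingTrails

section EdgeCounting

variable {V : Type*} {G : SimpleGraph V} [DecidableRel G.Adj]

theorem sum_card_filter_adj_comm (A B : Finset V) :
    ∑ v ∈ A, #{w ∈ B | G.Adj v w} = ∑ w ∈ B, #{v ∈ A | G.Adj w v} := by
  simpa only [bipartiteAbove, bipartiteBelow, G.adj_comm] using
    sum_card_bipartiteAbove_eq_sum_card_bipartiteBelow (s := A) (t := B) G.Adj

variable [Fintype V] {v : V} {B : Finset V}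

theorem degree_eq_card_filter_adj (G : SimpleGraph V) [DecidableRel G.Adj] (v : V) :
    G.degree v = #{w | G.Adj v w} := by
  rw [← SimpleGraph.card_neighborFinset_eq_degree, SimpleGraph.neighborFinset_eq_filter]

theorem degree_eq_card_filter_add_card_filter_compl [DecidableEq V] (v : V) (B : Finset V) :
    G.degree v = #{w ∈ B | G.Adj v w} + #{w ∈ Bᶜ | G.Adj v w} := by
  rw [degree_eq_card_filter_adj,
    ← card_union_of_disjoint (disjoint_filter_filter disjoint_compl_right),
    ← filter_union, union_compl]

theorem nontrivial_neighborSet_iff : (G.neighborSet v).Nontrivial ↔ 1 < G.degree v := by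
  rw [← SimpleGraph.card_neighborFinset_eq_degree, one_lt_card_iff_nontrivial, Finset.Nontrivial,
    SimpleGraph.coe_neighborFinset]

theorem card_erase_compl [DecidableEq V] (hv : v ∉ B) :
    #(Bᶜ.erase v) = Fintype.card V - 1 - #B := by
  rw [card_erase_of_mem (mem_compl.2 hv), card_compl]
  omega

theorem degree_le_add_card_filter_adj (hv : v ∉ B) :
    G.degree v ≤ Fintype.card V - 1 - #B + #{w ∈ B | G.Adj v w} := by
  classical
  rw [degree_eq_card_filter_add_card_filter_compl v B, add_comm, ← card_erase_compl hv]
  gcongr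
  intro w hw
  obtain ⟨hwB, hvw⟩ := mem_filter.1 hw
  exact mem_erase.2 ⟨hvw.ne', hwB⟩

theorem add_card_filter_adj_le_degree (hv : v ∉ B) (hadj : ∀ w ∉ B, w ≠ v → G.Adj v w) :
    Fintype.card V - 1 - #B + #{w ∈ B | G.Adj v w} ≤ G.degree v := by
  classical
  rw [degree_eq_card_filter_add_card_filter_compl v B, add_comm, ← card_erase_compl hv]
  gcongr
  intro w hw
  obtain ⟨hwv, hwB⟩ := mem_erase.1 hw
  exact mem_filter.2 ⟨hwB, hadj w (mem_compl.1 hwB) hwv⟩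

theorem sum_degree_le {A : Finset V} (hAB : Disjoint A B) :
    ∑ v ∈ A, G.degree v ≤ #A * (Fintype.card V - 1 - #B) + ∑ v ∈ B, G.degree v :=
  calc ∑ v ∈ A, G.degree v
      ≤ ∑ v ∈ A, (Fintype.card V - 1 - #B + #{w ∈ B | G.Adj v w}) :=
        sum_le_sum fun _ hv => degree_le_add_card_filter_adj (disjoint_left.1 hAB hv)
    _ = #A * (Fintype.card V - 1 - #B) + ∑ w ∈ B, #{v ∈ A | G.Adj w v} := by
        rw [sum_add_distrib, sum_const, smul_eq_mul, sum_card_filter_adj_comm]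
    _ ≤ #A * (Fintype.card V - 1 - #B) + ∑ w ∈ B, G.degree w := by
        gcongr with w
        rw [degree_eq_card_filter_adj]
        gcongr
        exact subset_univ A

end EdgeCounting

section Region

variable {n : ℕ} {d e : Fin n → ℕ}

-- The Erdős–Gallai inequality.
theorem IsGraphic.sum_le (h : IsGraphic d) {A B : Finset (Fin n)} (hAB : Disjoint A B) :
    ∑ i ∈ A, d i ≤ #A * (n - 1 - #B) + ∑ i ∈ B, d i := by
  classical
  obtain ⟨G, hG⟩ := h
  simpa only [mem_realizations.1 hG, Fintype.card_fin] using sum_degree_le (G := G) hAB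

theorem IsGraphic.sum_card_filter_adj_le (he : IsGraphic e) {G : SimpleGraph (Fin n)}
    [DecidableRel G.Adj] {A M : Finset (Fin n)} (hAM : Disjoint A M)
    (hadj : ∀ p ∈ A, ∀ v ∉ M, v ≠ p → G.Adj p v) (hdeg : ∀ p ∈ A, G.degree p ≤ e p) :
    ∑ v ∈ M, #{p ∈ A | G.Adj v p} ≤ ∑ v ∈ M, e v := by
  have hA : ∑ p ∈ A, (n - 1 - #M + #{v ∈ M | G.Adj p v}) ≤ #A * (n - 1 - #M) + ∑ v ∈ M, e v :=
    calc ∑ p ∈ A, (n - 1 - #M + #{v ∈ M | G.Adj p v})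
        ≤ ∑ p ∈ A, e p := sum_le_sum fun p hp => by
          simpa using (add_card_filter_adj_le_degree (disjoint_left.1 hAM hp) (hadj p hp)).trans
            (hdeg p hp)
      _ ≤ #A * (n - 1 - #M) + ∑ v ∈ M, e v := he.sum_le hAM
  rw [sum_add_distrib, sum_const, smul_eq_mul, sum_card_filter_adj_comm] at hA
  exact Nat.le_of_add_le_add_left hA

theorem IsGraphic.sum_compl_lt (he : IsGraphic e) {G : SimpleGraph (Fin n)}
    [DecidableRel G.Adj] {B M : Finset (Fin n)} (hBM : B ⊆ M)
    (hadj : ∀ q ∈ B, ∀ w ∈ M, ¬ G.Adj q w) (hle : ∀ q ∈ B, e q ≤ G.degree q)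
    (hlt : ∃ q ∈ B, e q < G.degree q) :
    ∑ v ∈ Mᶜ, e v < ∑ v ∈ Mᶜ, (n - 1 - #B + #{q ∈ B | G.Adj v q}) := by
  have hdeg : ∀ q ∈ B, G.degree q = #{v ∈ Mᶜ | G.Adj q v} := fun q hq => by
    rw [degree_eq_card_filter_add_card_filter_compl q M, filter_false_of_mem (hadj q hq),
      card_empty, zero_add]
  calc ∑ v ∈ Mᶜ, e v
      ≤ #Mᶜ * (n - 1 - #B) + ∑ q ∈ B, e q :=
        he.sum_le (disjoint_compl_left.mono_right hBM)
    _ < #Mᶜ * (n - 1 - #B) + ∑ q ∈ B, G.degree q := by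
        exact Nat.add_lt_add_left (sum_lt_sum hle hlt) _
    _ = ∑ v ∈ Mᶜ, (n - 1 - #B + #{q ∈ B | G.Adj v q}) := by
        rw [sum_congr rfl hdeg, ← sum_card_filter_adj_comm, sum_add_distrib, sum_const,
          smul_eq_mul]

variable {S a b : ℕ}

theorem exists_mem_simpleRegion_transfer (hb : 0 < b) (ha : a < n) (hd : d ∈ simpleRegion n S a b)
    {p q : Fin n} (hpq : p ≠ q) (hp : b < d p) (hq : d q < a) :
    ∃ e ∈ simpleRegion n S a b, e + Pi.single p 1 = d + Pi.single q 1 := by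
  obtain ⟨⟨-, heven⟩, hda, hdb, hS⟩ := hd
  set e : Fin n → ℕ := d + Pi.single q 1 - Pi.single p 1
  have hle : Pi.single p 1 ≤ d + Pi.single q 1 := fun i => by
    rw [Pi.add_apply, Pi.single_apply]
    split_ifs with hi
    · subst hi
      exact (Nat.one_le_of_lt hp).trans (Nat.le_add_right _ _)
    · exact Nat.zero_le _
  have he : e + Pi.single p 1 = d + Pi.single q 1 := tsub_add_cancel_of_le hle
  have hsum : ∑ i, e i = S := by
    have := congrArg (fun f : Fin n → ℕ => ∑ i, f i) he
    simpa [sum_add_distrib, hS] using this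
  have hbounds : ∀ i, b ≤ e i ∧ e i ≤ a := fun i => by
    have hei := congrFun he i
    simp only [Pi.add_apply, Pi.single_apply] at hei
    grind
  exact ⟨e, ⟨⟨fun i => ⟨hb.trans_le (hbounds i).1, (hbounds i).2.trans_lt ha⟩, hsum ▸ hS ▸ heven⟩,
    fun i => (hbounds i).2, fun i => (hbounds i).1, hsum⟩, he⟩

theorem exists_mem_simpleRegion_shift (hb : 0 < b) (ha : a < n) (M : Finset (Fin n))
    (hd : d ∈ simpleRegion n S a b) :
    ∃ e ∈ simpleRegion n S a b, (∀ i ∉ M, d i ≤ e i) ∧ (∀ i ∈ M, e i ≤ d i) ∧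
      ((∀ i ∈ M, e i = b) ∨ ∀ i ∉ M, e i = a) := by
  induction hk : ∑ i ∈ M, d i using Nat.strong_induction_on generalizing d with
  | _ k ih =>
  by_cases hMb : ∀ i ∈ M, d i = b
  · exact ⟨d, hd, fun _ _ => le_rfl, fun _ _ => le_rfl, .inl hMb⟩
  by_cases hMa : ∀ i ∉ M, d i = a
  · exact ⟨d, hd, fun _ _ => le_rfl, fun _ _ => le_rfl, .inr hMa⟩
  push Not at hMb hMa
  obtain ⟨p, hpM, hpb⟩ := hMb
  obtain ⟨q, hqM, hqa⟩ := hMa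
  obtain ⟨d', hd', htransfer⟩ := exists_mem_simpleRegion_transfer hb ha hd
    (ne_of_mem_of_not_mem hpM hqM) (lt_of_le_of_ne (hd.2.2.1 p) hpb.symm)
    (lt_of_le_of_ne (hd.2.1 q) hqa)
  have hd'_apply : ∀ i, d' i + (if i = p then 1 else 0) = d i + (if i = q then 1 else 0) :=
    fun i => by simpa only [Pi.add_apply, Pi.single_apply] using congrFun htransfer i
  have hout : ∀ i ∉ M, d i ≤ d' i := by grind
  have hin : ∀ i ∈ M, d' i ≤ d i := by grind
  have hlt : ∑ i ∈ M, d' i < k := hk ▸ sum_lt_sum hin ⟨p, hpM, by grind⟩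
  obtain ⟨e, he, hout_e, hin_e, hextreme⟩ := ih _ hlt hd' rfl
  exact ⟨e, he, fun i hi => (hout i hi).trans (hout_e i hi),
    fun i hi => (hin_e i hi).trans (hin i hi), hextreme⟩

theorem FullyGraphic.exists_notMem_card_lt {c₁ c₂ : ℕ} (hc₂ : 0 < c₂) (hc₁ : c₁ < n)
    (hfull : FullyGraphic (simpleRegion n S c₁ c₂)) (hd : d ∈ simpleRegion n S c₁ c₂)
    {G : SimpleGraph (Fin n)} [DecidableRel G.Adj] {x y : Fin n}
    (hG : G ∈ realizations (perturb d x y)) {A B M : Finset (Fin n)}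
    (hxA : x ∉ A) (hyA : y ∉ A) (hAM : Disjoint A M)
    (hA : ∀ p ∈ A, ∀ v ∉ M, v ≠ p → G.Adj p v)
    (hyB : y ∈ B) (hBM : B ⊆ M) (hB : ∀ q ∈ B, ∀ w ∈ M, ¬ G.Adj q w)
    (hM : ∀ v ∈ M, c₂ ≤ #{p ∈ A | G.Adj v p}) (hy : c₂ < #{p ∈ A | G.Adj y p}) :
    ∃ v ∉ M, #{q ∈ B | ¬ G.Adj v q} + c₁ + 1 < n := by
  by_contra! hMc
  have hdeg := degree_eq_of_mem_realizations_perturb hG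
  obtain ⟨e, he, hout, hin, hMe | hMe⟩ := exists_mem_simpleRegion_shift hc₂ hc₁ M hd
  · have hle : ∑ v ∈ M, #{p ∈ A | G.Adj v p} ≤ ∑ v ∈ M, e v :=
      (hfull e he).sum_card_filter_adj_le hAM hA fun p hp => by
        have hpx : p ≠ x := ne_of_mem_of_not_mem hp hxA
        have hpy : p ≠ y := ne_of_mem_of_not_mem hp hyA
        simpa only [hdeg, hpx, hpy, if_false, add_zero] using hout p (disjoint_left.1 hAM hp)
    have hlt : ∑ v ∈ M, e v < ∑ v ∈ M, #{p ∈ A | G.Adj v p} :=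
      sum_lt_sum (fun v hv => (hMe v hv).trans_le (hM v hv))
        ⟨y, hBM hyB, (hMe y (hBM hyB)).trans_lt hy⟩
    exact hle.not_gt hlt
  · have hlt : ∑ v ∈ Mᶜ, e v < ∑ v ∈ Mᶜ, (n - 1 - #B + #{q ∈ B | G.Adj v q}) :=
      (hfull e he).sum_compl_lt hBM hB
        (fun q hq => (hin q (hBM hq)).trans (by rw [hdeg q]; omega))
        ⟨y, hyB, (hin y (hBM hyB)).trans_lt (by rw [hdeg y, if_pos rfl]; omega)⟩
    have hle : ∑ v ∈ Mᶜ, (n - 1 - #B + #{q ∈ B | G.Adj v q}) ≤ ∑ v ∈ Mᶜ, e v :=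
      sum_le_sum fun v hv => by
        have hvM : v ∉ M := mem_compl.1 hv
        have hBn : #B < n := by
          simpa using card_lt_univ_of_notMem fun hvB => hvM (hBM hvB)
        have hsplit := card_filter_add_card_filter_not (s := B) (G.Adj v ·)
        have := hMc v hvM
        rw [hMe v hvM]
        omega
    exact hle.not_gt hlt

end Region

section ShortTrails

variable {V : Type*} {G : SimpleGraph V} {x y u u' z z' p p' q q' t : V}

/-- `p` is reached from `y` by the alternating path `y, u, z, p`. -/
structure ReachesVia (G : SimpleGraph V) (y u z p : V) : Prop where
  adj_left : G.Adj y u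
  compl_adj : Gᶜ.Adj u z
  adj_right : G.Adj z p

/-- A non-neighbour of `y` that is reached through two different neighbours of `y`. -/
def IsDoublyReached (G : SimpleGraph V) (y p : V) : Prop :=
  ¬ G.Adj y p ∧ ∃ u u' z z', u ≠ u' ∧ ReachesVia G y u z p ∧ ReachesVia G y u' z' p

/-- A non-neighbour of `y` that is reached along two paths without a common inner vertex. -/
def IsDisjointlyReached (G : SimpleGraph V) (y p : V) : Prop :=
  ¬ G.Adj y p ∧ ∃ u u' z z', u ≠ u' ∧ z ≠ z' ∧ ReachesVia G y u z p ∧ ReachesVia G y u' z' p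

/-- The non-neighbours of `u` span an edge. -/
def MissesEdge (G : SimpleGraph V) (u : V) : Prop :=
  ∃ q q', G.Adj q q' ∧ Gᶜ.Adj u q ∧ Gᶜ.Adj u q'

/-- The neighbours of `y` and the doubly reached vertices. They form a clique unless there is a
short alternating trail. -/
def IsUpper (G : SimpleGraph V) (y p : V) : Prop :=
  G.Adj y p ∨ IsDoublyReached G y p

/-- The upper vertices whose non-neighbours have no lower neighbour unless there is a short
alternating trail. -/
def IsTop (G : SimpleGraph V) (y p : V) : Prop :=
  (G.Adj y p ∧ ¬ MissesEdge G p) ∨ IsDisjointlyReached G y p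

/-- The vertex `y` and the vertices with an upper non-neighbour. -/
def IsLower (G : SimpleGraph V) (y q : V) : Prop :=
  q = y ∨ ∃ p, IsUpper G y p ∧ Gᶜ.Adj p q

/-- The vertex `y` and the vertices with a top non-neighbour. -/
def IsBottom (G : SimpleGraph V) (y q : V) : Prop :=
  q = y ∨ ∃ p, IsTop G y p ∧ Gᶜ.Adj p q

theorem IsDisjointlyReached.isDoublyReached (h : IsDisjointlyReached G y p) :
    IsDoublyReached G y p :=
  let ⟨hyp, u, u', z, z', hne, _, hp, hp'⟩ := h
  ⟨hyp, u, u', z, z', hne, hp, hp'⟩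

theorem IsTop.isUpper (h : IsTop G y p) : IsUpper G y p :=
  h.imp And.left IsDisjointlyReached.isDoublyReached

theorem IsBottom.isLower (h : IsBottom G y q) : IsLower G y q :=
  h.imp_right fun ⟨p, hp, hpq⟩ => ⟨p, hp.isUpper, hpq⟩

theorem IsDoublyReached.ne_of_adj (h : IsDoublyReached G y p) (hu : G.Adj y u) : u ≠ p :=
  fun hup => h.1 (hup ▸ hu)

theorem IsDoublyReached.exists_ne (h : IsDoublyReached G y p) (u₀ : V) :
    ∃ u z, u ≠ u₀ ∧ ReachesVia G y u z p := by
  obtain ⟨-, u, u', z, z', hne, hp, hp'⟩ := h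
  by_cases hu : u = u₀
  · exact ⟨u', z', fun hu' => hne (hu.trans hu'.symm), hp'⟩
  · exact ⟨u, z, hu, hp⟩

/-- Every neighbour of `y` is a neighbour of `x`, but no alternating trail with at most nine steps
leads from `y` to `x`. -/
structure IsStuck (G : SimpleGraph V) (x y : V) : Prop where
  adj_of_adj : ∀ u, G.Adj y u → G.Adj x u
  not_isAltTrail : ∀ l : List V, l.length ≤ 9 → ¬ IsAltTrail G x y l

namespace IsStuck

theorem ne_of_adj (h : IsStuck G x y) (hu : G.Adj y u) : u ≠ x ∧ u ≠ y :=
  ⟨(h.adj_of_adj u hu).ne', hu.ne'⟩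

theorem not_adj_of_compl_adj (h : IsStuck G x y) (hu : G.Adj y u) (hz : Gᶜ.Adj u z) :
    ¬ G.Adj x z ∧ ¬ G.Adj y z ∧ z ≠ x ∧ z ≠ y := by
  have hxu := h.adj_of_adj u hu
  have hxz : ¬ G.Adj x z := by
    intro hxz
    refine h.not_isAltTrail [u, z, x] (by simp) ⟨⟨hu, hz, rfl, hxz.symm⟩, ?_, ?_⟩
    all_goals
      have := hz.ne
      have := hxu.ne
      simp only [blocks, List.nodup_cons, List.mem_cons, Sym2.eq_iff]
      grind
  refine ⟨hxz, fun hyz => hxz (h.adj_of_adj z hyz), ?_, ?_⟩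
  · rintro rfl
    exact hz.2 hxu.symm
  · rintro rfl
    exact hz.2 hu.symm

theorem adj_of_adj_of_adj (h : IsStuck G x y) (hu : G.Adj y u) (hu' : G.Adj y u') (hne : u ≠ u') :
    G.Adj u u' := by
  by_contra huu'
  exact (h.not_adj_of_compl_adj hu ⟨hne, huu'⟩).2.1 hu'

theorem ne_of_isDoublyReached (h : IsStuck G x y) (hp : IsDoublyReached G y p) :
    p ≠ x ∧ p ≠ y := by
  obtain ⟨u, z, -, hu, hz, hzp⟩ := hp.exists_ne y
  have hnot := h.not_adj_of_compl_adj hu hz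
  exact ⟨fun hpx => hnot.1 (hpx ▸ hzp.symm), fun hpy => hnot.2.1 (hpy ▸ hzp.symm)⟩

theorem ne_of_isUpper (h : IsStuck G x y) (hp : IsUpper G y p) : p ≠ x ∧ p ≠ y :=
  hp.elim h.ne_of_adj h.ne_of_isDoublyReached

theorem adj_of_adj_of_isDoublyReached (h : IsStuck G x y) (hu : G.Adj y u)
    (hp : IsDoublyReached G y p) : G.Adj u p := by
  by_contra hup
  obtain ⟨u', z, hne, hu', hz, hzp⟩ := hp.exists_ne u
  have hup' : Gᶜ.Adj u p := ⟨hp.ne_of_adj hu, hup⟩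
  refine h.not_isAltTrail [u, p, z, u', x] (by simp)
    ⟨⟨hu, hup', hzp.symm, hz.symm, rfl, (h.adj_of_adj u' hu').symm⟩, ?_, ?_⟩
  all_goals
    have := h.not_adj_of_compl_adj hu' hz
    have := h.ne_of_adj hu'
    simp only [blocks, List.nodup_cons, List.mem_cons, Sym2.eq_iff]
    grind

theorem adj_of_isDoublyReached (h : IsStuck G x y) (hp : IsDoublyReached G y p)
    (hp' : IsDoublyReached G y p') (hne : p ≠ p') : G.Adj p p' := by
  by_contra hpp'
  obtain ⟨u, z, -, hu, hz, hzp⟩ := hp.exists_ne y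
  obtain ⟨u', z', huu', hu', hz', hzp'⟩ := hp'.exists_ne u
  refine h.not_isAltTrail [u, z, p, p', z', u', x] (by simp)
    ⟨⟨hu, hz, hzp, ⟨hne, hpp'⟩, hzp'.symm, hz'.symm, rfl, (h.adj_of_adj u' hu').symm⟩, ?_, ?_⟩
  all_goals
    have := h.not_adj_of_compl_adj hu hz
    have := h.not_adj_of_compl_adj hu' hz'
    have := h.ne_of_adj hu'
    have := hp.ne_of_adj hu'
    have := hp'.ne_of_adj hu
    have : z ≠ p' := fun hzp' => hz.2 (hzp' ▸ h.adj_of_adj_of_isDoublyReached hu hp')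
    have : u ≠ z' := fun huz' => (h.not_adj_of_compl_adj hu' hz').2.1 (huz' ▸ hu)
    simp only [blocks, List.nodup_cons, List.mem_cons, Sym2.eq_iff]
    grind

theorem adj_of_isUpper (h : IsStuck G x y) (hp : IsUpper G y p) (hp' : IsUpper G y p')
    (hne : p ≠ p') : G.Adj p p' := by
  rcases hp with hp | hp <;> rcases hp' with hp' | hp'
  · exact h.adj_of_adj_of_adj hp hp' hne
  · exact h.adj_of_adj_of_isDoublyReached hp hp'
  · exact (h.adj_of_adj_of_isDoublyReached hp' hp).symm
  · exact h.adj_of_isDoublyReached hp hp' hne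

theorem ne_of_isUpper_of_isLower (h : IsStuck G x y) (hp : IsUpper G y p) (hq : IsLower G y q) :
    p ≠ q := by
  rintro rfl
  rcases hq with rfl | ⟨p', hp', hcompl⟩
  · exact (h.ne_of_isUpper hp).2 rfl
  · exact hcompl.2 (h.adj_of_isUpper hp' hp hcompl.ne)

theorem not_adj_of_ne_neighbors (h : IsStuck G x y) (hu : G.Adj y u) (hu' : G.Adj y u')
    (hne : u ≠ u') (hq : Gᶜ.Adj u q) (hq' : Gᶜ.Adj u' q') : ¬ G.Adj q q' := by
  intro hqq'
  refine h.not_isAltTrail [u, q, q', u', x] (by simp)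
    ⟨⟨hu, hq, hqq', hq'.symm, rfl, (h.adj_of_adj u' hu').symm⟩, ?_, ?_⟩
  all_goals
    have := h.not_adj_of_compl_adj hu' hq'
    have := h.ne_of_adj hu'
    simp only [blocks, List.nodup_cons, List.mem_cons, Sym2.eq_iff]
    grind

theorem not_adj_of_neighbor_of_isDoublyReached (h : IsStuck G x y) (hu : G.Adj y u)
    (hp : IsDoublyReached G y p) (hq : Gᶜ.Adj u q) (hq' : Gᶜ.Adj p q') : ¬ G.Adj q q' := by
  intro hqq'
  obtain ⟨u', z, hne, hu', hz, hzp⟩ := hp.exists_ne u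
  have hpq : p ≠ q := h.ne_of_isUpper_of_isLower (.inr hp) (.inr ⟨u, .inl hu, hq⟩)
  have hu'q' : u' ≠ q' := h.ne_of_isUpper_of_isLower (.inl hu') (.inr ⟨p, .inr hp, hq'⟩)
  refine h.not_isAltTrail [u, q, q', p, z, u', x] (by simp)
    ⟨⟨hu, hq, hqq', hq'.symm, hzp.symm, hz.symm, rfl, (h.adj_of_adj u' hu').symm⟩, ?_, ?_⟩
  all_goals
    have := h.not_adj_of_compl_adj hu' hz
    have := h.not_adj_of_compl_adj hu hq
    have := h.ne_of_adj hu'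
    have := hp.ne_of_adj hu'
    have := hq'.ne
    have := hqq'.ne
    simp only [blocks, List.nodup_cons, List.mem_cons, Sym2.eq_iff]
    grind

theorem not_adj_of_reachesVia (h : IsStuck G x y) (hp : IsDoublyReached G y p)
    (hp' : IsDoublyReached G y p') (huzp : ReachesVia G y u z p) (huzp' : ReachesVia G y u' z' p')
    (huu' : u ≠ u') (hne : p ≠ p' ∨ z ≠ z') (hq : Gᶜ.Adj p q) (hq' : Gᶜ.Adj p' q') :
    ¬ G.Adj q q' := by
  intro hqq'
  obtain ⟨hu, hz, hzp⟩ := huzp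
  obtain ⟨hu', hz', hzp'⟩ := huzp'
  have upper : ∀ v ∈ [u, u', p, p'], IsUpper G y v := by
    simpa using ⟨.inl hu, .inl hu', .inr hp, .inr hp'⟩
  have lower : ∀ w ∈ [z, z', q, q'], IsLower G y w := by
    simpa using ⟨.inr ⟨u, .inl hu, hz⟩, .inr ⟨u', .inl hu', hz'⟩, .inr ⟨p, .inr hp, hq⟩,
      .inr ⟨p', .inr hp', hq'⟩⟩
  have upper_ne_lower : ∀ v ∈ [u, u', p, p'], ∀ w ∈ [z, z', q, q'], v ≠ w :=
    fun v hv w hw => h.ne_of_isUpper_of_isLower (upper v hv) (lower w hw)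
  simp only [List.forall_mem_cons, List.not_mem_nil, false_imp_iff, implies_true, and_true]
    at upper_ne_lower
  refine h.not_isAltTrail [u, z, p, q, q', p', z', u', x] (by simp)
    ⟨⟨hu, hz, hzp, hq, hqq', hq'.symm, hzp'.symm, hz'.symm, rfl, (h.adj_of_adj u' hu').symm⟩,
      ?_, ?_⟩
  all_goals
    have := h.ne_of_adj hu'
    have := hp.ne_of_adj hu
    have := hp.ne_of_adj hu'
    have := hp'.ne_of_adj hu
    have := hp'.ne_of_adj hu'
    have := hqq'.ne
    clear h upper lower
    simp only [blocks, List.nodup_cons, List.mem_cons, Sym2.eq_iff]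
    grind

theorem not_adj_of_isBottom (h : IsStuck G x y) (hq : IsBottom G y q) (hq' : IsLower G y q') :
    ¬ G.Adj q q' := by
  intro hqq'
  have hlower := hq.isLower
  rcases hq with rfl | ⟨p, hp, hpq⟩
  · exact h.ne_of_isUpper_of_isLower (.inl hqq') hq' rfl
  rcases hq' with rfl | ⟨p', hp', hpq'⟩
  · exact h.ne_of_isUpper_of_isLower (.inl hqq'.symm) hlower rfl
  rcases hp with ⟨hp, hmiss⟩ | hp <;> rcases hp' with hp' | hp'
  · by_cases hpp' : p = p'
    · subst hpp'
      exact hmiss ⟨q, q', hqq', hpq, hpq'⟩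
    · exact h.not_adj_of_ne_neighbors hp hp' hpp' hpq hpq' hqq'
  · exact h.not_adj_of_neighbor_of_isDoublyReached hp hp' hpq hpq' hqq'
  · exact h.not_adj_of_neighbor_of_isDoublyReached hp' hp.isDoublyReached hpq' hpq hqq'.symm
  · by_cases hpp' : p = p'
    · subst hpp'
      obtain ⟨-, u, u', z, z', huu', hzz', huzp, huzp'⟩ := hp
      exact h.not_adj_of_reachesVia hp' hp' huzp huzp' huu' (.inr hzz') hpq hpq' hqq'
    · obtain ⟨u, z, -, huzp⟩ := hp.isDoublyReached.exists_ne y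
      obtain ⟨u', z', huu', huzp'⟩ := hp'.exists_ne u
      exact h.not_adj_of_reachesVia hp.isDoublyReached hp' huzp huzp' huu'.symm (.inl hpp')
        hpq hpq' hqq'

theorem compl_adj_of_missesEdge (h : IsStuck G x y) (hmiss : MissesEdge G u) (hu : G.Adj y u)
    (hu' : G.Adj y u') (hne : u ≠ u') (ht : Gᶜ.Adj u' t) : Gᶜ.Adj u t := by
  have hut : u ≠ t := by
    rintro rfl
    exact ht.2 (h.adj_of_adj_of_adj hu' hu hne.symm)
  refine ⟨hut, fun hadj => ?_⟩
  obtain ⟨q, q', hqq', hq, hq'⟩ := hmiss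
  refine h.not_isAltTrail [u, q, q', u, t, u', x] (by simp)
    ⟨⟨hu, hq, hqq', hq'.symm, hadj, ht.symm, rfl, (h.adj_of_adj u' hu').symm⟩, ?_, ?_⟩
  all_goals
    have := h.not_adj_of_compl_adj hu' ht
    have := h.not_adj_of_compl_adj hu hq'
    have := hq.ne
    have := hqq'.ne
    simp only [blocks, List.nodup_cons, List.mem_cons, Sym2.eq_iff]
    grind

theorem not_missesEdge (h : IsStuck G x y) (hmiss : MissesEdge G u) (hu : G.Adj y u)
    (hu' : G.Adj y u') (hne : u ≠ u') : ¬ MissesEdge G u' := by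
  rintro ⟨q, q', hqq', hq, hq'⟩
  exact h.not_adj_of_ne_neighbors hu hu' hne (h.compl_adj_of_missesEdge hmiss hu hu' hne hq) hq'
    hqq'

theorem exists_isTop (h : IsStuck G x y) (hy : (G.neighborSet y).Nontrivial) (v : V) :
    ∃ u, IsTop G y u ∧ ((∀ z, Gᶜ.Adj u z → ¬ G.Adj v z) ∨
      (G.Adj y u ∧ ¬ G.Adj y v ∧ {z | Gᶜ.Adj u z ∧ G.Adj v z}.Subsingleton)) := by
  by_cases htop : IsTop G y v
  · exact ⟨v, htop, .inl fun z hz => hz.2⟩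
  by_cases hyv : G.Adj y v
  · have hmiss : MissesEdge G v := not_not.1 fun hmiss => htop (.inl ⟨hyv, hmiss⟩)
    obtain ⟨u, hu, hne⟩ := hy.exists_ne v
    exact ⟨u, .inl ⟨hu, h.not_missesEdge hmiss hyv hu hne.symm⟩,
      .inl fun z hz => (h.compl_adj_of_missesEdge hmiss hyv hu hne.symm hz).2⟩
  obtain ⟨u, u', hu, hu', hne, hmiss⟩ :
      ∃ u u', G.Adj y u ∧ G.Adj y u' ∧ u ≠ u' ∧ ¬ MissesEdge G u := by
    obtain ⟨u, hu, u', hu', hne⟩ := hy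
    by_cases hmiss : MissesEdge G u
    · exact ⟨u', u, hu', hu, hne.symm, h.not_missesEdge hmiss hu hu' hne⟩
    · exact ⟨u, u', hu, hu', hne, hmiss⟩
  rcases Set.subsingleton_or_nontrivial {z | Gᶜ.Adj u z ∧ G.Adj v z} with
    hlost | ⟨z₁, ⟨huz₁, hvz₁⟩, z₂, ⟨huz₂, hvz₂⟩, hz⟩
  · exact ⟨u, .inl ⟨hu, hmiss⟩, .inr ⟨hu, hyv, hlost⟩⟩
  have hnone : ∀ z, Gᶜ.Adj u' z → ¬ G.Adj v z := by
    intro z hu'z hvz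
    refine htop (.inr ⟨hyv, ?_⟩)
    by_cases hzz₁ : z = z₁
    · exact ⟨u', u, z, z₂, hne.symm, hzz₁ ▸ hz, ⟨hu', hu'z, hvz.symm⟩, ⟨hu, huz₂, hvz₂.symm⟩⟩
    · exact ⟨u', u, z, z₁, hne.symm, hzz₁, ⟨hu', hu'z, hvz.symm⟩, ⟨hu, huz₁, hvz₁.symm⟩⟩
  have hmiss' : ¬ MissesEdge G u' := fun hmiss' =>
    hnone z₁ (h.compl_adj_of_missesEdge hmiss' hu' hu hne.symm huz₁) hvz₁
  exact ⟨u', .inl ⟨hu', hmiss'⟩, .inl hnone⟩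

end IsStuck

end ShortTrails

section Existence

variable {V : Type*} [Fintype V] {G : SimpleGraph V} {x y v : V}

open Classical in
theorem IsStuck.le_card_filter_isUpper (h : IsStuck G x y) (hv : IsLower G y v) {k : ℕ}
    (hdeg : k ≤ G.degree v) (hdeg_y : k < G.degree y) :
    k ≤ #{p | IsUpper G y p ∧ G.Adj v p} := by
  by_cases hmissed : #{u | G.Adj y u ∧ ¬ G.Adj v u} ≤ 1
  · have hsplit := card_filter_add_card_filter_not (s := {u | G.Adj y u}) (G.Adj v ·)
    rw [filter_filter, filter_filter, ← degree_eq_card_filter_adj] at hsplit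
    have hle : #{u | G.Adj y u ∧ G.Adj v u} ≤ #{p | IsUpper G y p ∧ G.Adj v p} :=
      card_le_card (monotone_filter_right _ fun u _ hu => hu.imp_left .inl)
    omega
  · obtain ⟨u, hu, u', hu', hne⟩ := one_lt_card.1 (not_le.1 hmissed)
    obtain ⟨hyu, hvu⟩ := (mem_filter.1 hu).2
    obtain ⟨hyu', hvu'⟩ := (mem_filter.1 hu').2
    have hcompl : Gᶜ.Adj u v :=
      ⟨h.ne_of_isUpper_of_isLower (.inl hyu) hv, fun h => hvu h.symm⟩
    have hcompl' : Gᶜ.Adj u' v :=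
      ⟨h.ne_of_isUpper_of_isLower (.inl hyu') hv, fun h => hvu' h.symm⟩
    rw [degree_eq_card_filter_adj] at hdeg
    refine hdeg.trans (card_le_card (monotone_filter_right _ fun w _ hvw => ⟨?_, hvw⟩))
    exact or_iff_not_imp_left.2 fun hyw =>
      ⟨hyw, u, u', v, v, hne, ⟨hyu, hcompl, hvw⟩, ⟨hyu', hcompl', hvw⟩⟩

open Classical in
theorem IsStuck.exists_degree_compl_le (h : IsStuck G x y) (hy : 1 < G.degree y) (v : V) :
    ∃ u, IsUpper G y u ∧ Gᶜ.degree u ≤ #{q | IsBottom G y q ∧ ¬ G.Adj v q} := by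
  obtain ⟨u, hu, hnone | ⟨hyu, hyv, hlost⟩⟩ :=
    h.exists_isTop (nontrivial_neighborSet_iff.2 hy) v
  all_goals
    refine ⟨u, hu.isUpper, ?_⟩
    rw [degree_eq_card_filter_adj]
  · exact card_le_card (monotone_filter_right _ fun w _ huw => ⟨.inr ⟨u, hu, huw⟩, hnone w huw⟩)
  · have hlost_le : #{w | Gᶜ.Adj u w ∧ G.Adj v w} ≤ 1 :=
      card_le_one.2 fun z hz z' hz' => hlost (mem_filter.1 hz).2 (mem_filter.1 hz').2
    have hy_notMem : y ∉ ({w | Gᶜ.Adj u w ∧ ¬ G.Adj v w} : Finset V) := fun hy =>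
      (mem_filter.1 hy).2.1.2 hyu.symm
    calc #{w | Gᶜ.Adj u w}
        = #{w | Gᶜ.Adj u w ∧ G.Adj v w} + #{w | Gᶜ.Adj u w ∧ ¬ G.Adj v w} := by
          rw [← filter_filter, ← filter_filter, card_filter_add_card_filter_not]
      _ ≤ #(insert y ({w | Gᶜ.Adj u w ∧ ¬ G.Adj v w} : Finset V)) := by
          rw [card_insert_of_notMem hy_notMem, add_comm]
          gcongr
      _ ≤ #{q | IsBottom G y q ∧ ¬ G.Adj v q} := card_le_card <| insert_subset
          (mem_filter.2 ⟨mem_univ y, .inl rfl, fun hvy => hyv hvy.symm⟩)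
          (monotone_filter_right _ fun w _ hw => ⟨.inr ⟨u, hu, hw.1⟩, hw.2⟩)

theorem FullyGraphic.not_isStuck {n S c₁ c₂ : ℕ} (hc₂ : 0 < c₂) (hc₁ : c₁ < n)
    (hfull : FullyGraphic (simpleRegion n S c₁ c₂)) {d : Fin n → ℕ}
    (hd : d ∈ simpleRegion n S c₁ c₂) {G : SimpleGraph (Fin n)} {x y : Fin n}
    (hG : G ∈ realizations (perturb d x y)) : ¬ IsStuck G x y := by
  classical
  intro h
  have hdeg := degree_eq_of_mem_realizations_perturb hG
  have hdeg_ge : ∀ v, c₂ ≤ G.degree v := fun v => by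
    have := hd.2.2.1 v
    rw [hdeg]
    omega
  have hdeg_y : c₂ < G.degree y := by
    have := hd.2.2.1 y
    rw [hdeg, if_pos rfl]
    omega
  obtain ⟨v, -, hlt⟩ := hfull.exists_notMem_card_lt hc₂ hc₁ hd hG (A := {p | IsUpper G y p})
    (B := {q | IsBottom G y q}) (M := {q | IsLower G y q})
    (fun hx => (h.ne_of_isUpper (mem_filter.1 hx).2).1 rfl)
    (fun hy => (h.ne_of_isUpper (mem_filter.1 hy).2).2 rfl)
    (disjoint_left.2 fun p hp hp' =>
      h.ne_of_isUpper_of_isLower (mem_filter.1 hp).2 (mem_filter.1 hp').2 rfl)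
    (fun p hp v hv hvp => by
      by_contra hpv
      exact hv (mem_filter.2 ⟨mem_univ v, .inr ⟨p, (mem_filter.1 hp).2, hvp.symm, hpv⟩⟩))
    (mem_filter.2 ⟨mem_univ y, .inl rfl⟩)
    (monotone_filter_right _ fun q _ hq => hq.isLower)
    (fun q hq w hw => h.not_adj_of_isBottom (mem_filter.1 hq).2 (mem_filter.1 hw).2)
    (fun v hv => by
      rw [filter_filter]
      exact h.le_card_filter_isUpper (mem_filter.1 hv).2 (hdeg_ge v) hdeg_y)
    (by
      rw [degree_eq_card_filter_adj] at hdeg_y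
      rw [filter_filter]
      exact hdeg_y.trans_le (card_le_card (monotone_filter_right _ fun p _ hp => ⟨.inl hp, hp⟩)))
  obtain ⟨u, hu, hle⟩ := h.exists_degree_compl_le (by omega) v
  have hdeg_u : G.degree u ≤ c₁ := by
    simpa [hdeg, (h.ne_of_isUpper hu).1, (h.ne_of_isUpper hu).2] using hd.2.1 u
  rw [SimpleGraph.degree_compl, Fintype.card_fin] at hle
  rw [filter_filter] at hlt
  omega

theorem FullyGraphic.exists_isAltTrail {n S c₁ c₂ : ℕ} (hc₂ : 0 < c₂) (hc₁ : c₁ < n)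
    (hfull : FullyGraphic (simpleRegion n S c₁ c₂)) {d : Fin n → ℕ}
    (hd : d ∈ simpleRegion n S c₁ c₂) {G : SimpleGraph (Fin n)} {x y : Fin n}
    (hG : G ∈ realizations (perturb d x y)) (hsub : ∀ u, G.Adj y u → G.Adj x u) :
    ∃ l : List (Fin n), l.length ≤ 9 ∧ IsAltTrail G x y l := by
  by_contra! hcon
  exact hfull.not_isStuck hc₂ hc₁ hd hG ⟨hsub, hcon⟩

end Existence

section Counting

theorem ncard_le_of_exists_symmDiff {V ι : Type*} [Finite V] [Finite ι]
    {s t : Set (SimpleGraph V)} (g : ι → SimpleGraph V) (h : ∀ G ∈ s, ∃ i, G ∆ g i ∈ t) :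
    s.ncard ≤ Nat.card ι * t.ncard := by
  choose f hf using h
  let F (G : s) : ι × t := (f G G.2, ⟨G ∆ g (f G G.2), hf G G.2⟩)
  have hF : Function.Injective F := fun G H hGH => by
    have hindex : f G G.2 = f H H.2 := congrArg Prod.fst hGH
    have hgraph : (G : SimpleGraph V) ∆ g (f G G.2) = (H : SimpleGraph V) ∆ g (f H H.2) :=
      congrArg (fun p => (p.2 : SimpleGraph V)) hGH
    rw [hindex] at hgraph
    exact Subtype.ext (symmDiff_left_injective _ hgraph)
  simpa only [Nat.card_prod, Nat.card_coe_set_eq] using Nat.card_le_card_of_injective F hF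

theorem ncard_le_of_exists_parityGraph {V : Type*} [Fintype V] {s t : Set (SimpleGraph V)}
    (y : V) (k : ℕ) (h : ∀ G ∈ s, ∃ l : List V, l.length ≤ k ∧ G ∆ parityGraph (y :: l) ∈ t) :
    s.ncard ≤ Fintype.card V ^ k * t.ncard := by
  have hcard := ncard_le_of_exists_symmDiff (s := s) (t := t)
    (fun l : List.Vector V k => parityGraph (y :: l.1)) fun G hG => by
      obtain ⟨l, hl, hlt⟩ := h G hG
      refine ⟨⟨List.replicate (k - l.length) y ++ l, by simp [hl]⟩, ?_⟩
      rwa [parityGraph_cons_replicate_append]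
  rwa [Nat.card_eq_fintype_card, card_vector] at hcard

variable {n S c₁ c₂ : ℕ} {d : Fin n → ℕ}

theorem FullyGraphic.exists_parityGraph (hc₂ : 0 < c₂) (hc₁ : c₁ < n)
    (hfull : FullyGraphic (simpleRegion n S c₁ c₂)) (hd : d ∈ simpleRegion n S c₁ c₂)
    {G : SimpleGraph (Fin n)} {x y : Fin n} (hG : G ∈ realizations (perturb d x y)) :
    ∃ l : List (Fin n), l.length ≤ 11 ∧ G ∆ parityGraph (y :: l) ∈ realizations d := by
  by_cases hsub : ∀ u, G.Adj y u → G.Adj x u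
  · obtain ⟨l, hl, htrail⟩ := hfull.exists_isAltTrail hc₂ hc₁ hd hG hsub
    exact ⟨l, by omega, htrail.symmDiff_parityGraph_mem_realizations hG⟩
  push Not at hsub
  obtain ⟨w, hyw, hxw⟩ := hsub
  by_cases hwx : w = x
  · have htrail : IsAltTrail G x y [x] := ⟨⟨rfl, hwx ▸ hyw⟩, by simp [blocks], by simp [blocks]⟩
    exact ⟨[x], by simp, htrail.symmDiff_parityGraph_mem_realizations hG⟩
  · have hG' := symmDiff_edge_symmDiff_edge_mem_realizations_perturb hyw
      ⟨hwx, fun hwx => hxw hwx.symm⟩ hG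
    obtain ⟨l, hl, htrail⟩ := hfull.exists_isAltTrail hc₂ hc₁ hd hG' fun _ h => h
    refine ⟨w :: x :: l, by simp only [List.length_cons]; omega, ?_⟩
    rw [parityGraph, parityGraph, ← symmDiff_assoc, ← symmDiff_assoc]
    exact htrail.symmDiff_parityGraph_mem_realizations hG'

theorem boundary_le_boundaryWithDiagonal (d : Fin n → ℕ) : boundary d ≤ boundaryWithDiagonal d :=
  sum_le_sum_of_subset_of_nonneg (monotone_filter_right _ fun _ _ => le_of_lt)
    fun _ _ _ => by positivity

theorem FullyGraphic.boundaryWithDiagonal_le (hc₂ : 0 < c₂) (hc₁ : c₁ < n)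
    (hfull : FullyGraphic (simpleRegion n S c₁ c₂)) (hd : d ∈ simpleRegion n S c₁ c₂) :
    boundaryWithDiagonal d ≤ (n : ℚ) ^ 13 := by
  have hratio : ∀ x y : Fin n,
      ((realizations (perturb d x y)).ncard : ℚ) / (realizations d).ncard ≤ (n : ℚ) ^ 11 := by
    intro x y
    have hncard : (realizations (perturb d x y)).ncard ≤ n ^ 11 * (realizations d).ncard := by
      simpa only [Fintype.card_fin] using ncard_le_of_exists_parityGraph y 11
        fun G hG => hfull.exists_parityGraph hc₂ hc₁ hd hG
    exact div_le_of_le_mul₀ (by positivity) (by positivity) (mod_cast hncard)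
  calc boundaryWithDiagonal d
      ≤ ∑ p : Fin n × Fin n,
          ((realizations (perturb d p.1 p.2)).ncard : ℚ) / (realizations d).ncard :=
        sum_le_sum_of_subset_of_nonneg (filter_subset _ _) fun _ _ _ => by positivity
    _ ≤ ∑ _p : Fin n × Fin n, (n : ℚ) ^ 11 := sum_le_sum fun p _ => hratio p.1 p.2
    _ = (n : ℚ) ^ 13 := by
        rw [sum_const, card_univ, Fintype.card_prod, Fintype.card_fin, nsmul_eq_mul]
        push_cast
        ring

end Counting

end DegreeRegion

theorem theorem1p3 (n S c₁ c₂ : ℕ) (hc₂ : 0 < c₂) (hc : c₂ ≤ c₁) (hc₁ : c₁ < n)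
    (hfull : DegreeRegion.FullyGraphic (DegreeRegion.simpleRegion n S c₁ c₂)) :
    ∀ D ∈ DegreeRegion.simpleRegion n S c₁ c₂,
      DegreeRegion.boundary D ≤ 3 * (n : ℚ) ^ 13 ∧
      DegreeRegion.boundaryWithDiagonal D ≤ 3 * (n : ℚ) ^ 13 := by
  intro D hD
  have hdiagonal : DegreeRegion.boundaryWithDiagonal D ≤ 3 * (n : ℚ) ^ 13 :=
    (hfull.boundaryWithDiagonal_le hc₂ hc₁ hD).trans
      (le_mul_of_one_le_left (by positivity) (by norm_num))
  exact ⟨(DegreeRegion.boundary_le_boundaryWithDiagonal D).trans hdiagonal, hdiagonal⟩
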